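/- Let $\mathcal{X}=(X,\{R_i\}_{i=0}^d)$ be a $d$-class symmetric association scheme: $X$ is a finite nonempty set and $R_0,\dots,R_d$ are nonempty symmetric relations that partition $X\times X$, with $R_0$ the diagonal, such that for all $h,i,j$ the number of $z\in X$ with $(x,z)\in R_i$ and $(z,y)\in R_j$ is the same for every $(x,y)\in R_h$. Let $A_i\in \mathrm{Mat}_X(\mathbb{R})$ be the adjacency matrix of $R_i$. The span $M$ of $A_0,\dots,A_d$ is a commutative algebra of symmetric matrices (the Bose–Mesner algebra), also closed under the entrywise product $\circ$. Its primitive idempotents, that is, its minimal nonzero idempotents, form a second basis of $M$; one of them is the trivial primitive idempotent $|X|^{-1}J$, where $J$ is the all-ones matrix. For a primitive idempotent $F$, the eigenvalue of $A_i$ for $F$ is the coefficient of $F$ when $A_i$ is expanded in the basis of primitive idempotents. The dual eigenvalues $\theta^*_0,\dots,\theta^*_d$ of a primitive idempotent $E$ are defined by $E=|X|^{-1}\sum_{i=0}^d\theta^*_iA_i$; here $\theta^*_i$ is the dual eigenvalue of $E$ for $A_i$. For an enumeration $E_0,E_1,\dots,E_d$ of the primitive idempotents with $E_0=|X|^{-1}J$,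 the Krein parameters $q^h_{ij}$ are defined by $E_i\circ E_j=|X|^{-1}\sum_{h=0}^d q^h_{ij}E_h$. The ordering $E_1,\dots,E_d$ is $Q$-polynomial if for $0\le i,j\le d$ one has $q^1_{ij}=0$ whenever $|i-j|>1$ and $q^1_{ij}\neq 0$ whenever $|i-j|=1$. The scheme $\mathcal{X}$ is $Q$-polynomial relative to a nontrivial primitive idempotent $E$ if there is such a $Q$-polynomial ordering with $E_1=E$, and then $E_d$ is called the last primitive idempotent in this $Q$-polynomial structure. **Theorem.** Let $E$ and $F$ be primitive idempotents of $\mathcal{X}$ with $E$ nontrivial, and for $0\le i\le d$ let $\theta^*_i$ be the dual eigenvalue of $E$ for $A_i$. Then the following are equivalent. (i) $\mathcal{X}$ is $Q$-polynomial relative to $E$, and $F$ is the last primitive idempotent in this $Q$-polynomial structure. (ii) $\theta^*_0,\dots,\theta^*_d$ are mutually distinct, and for $0\le i\le d$ the eigenvalue of $A_i$ for $F$ is $$\frac{\prod_{0\le j\le d,\ j\neq 0}(\theta^*_0-\theta^*_j)}{\prod_{0\le j\le d,\ j\neq i}(\theta^*_i-\theta^*_j)}.$$ -/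

import Mathlib

/-- A `d`-class symmetric association scheme on the finite set `X`
(`X` is nonempty because the relation `rel 0` is). -/
structure SymmetricAssociationScheme (X : Type*) (d : ℕ) where
  /-- the relations `R_0, …, R_d` -/
  rel : Fin (d + 1) → Set (X × X)
  rel_nonempty : ∀ i, (rel i).Nonempty
  rel_zero : rel 0 = {p | p.1 = p.2}
  rel_disjoint : ∀ i j, i ≠ j → Disjoint (rel i) (rel j)
  rel_cover : ⋃ i, rel i = Set.univ
  rel_symm : ∀ i x y, (x, y) ∈ rel i → (y, x) ∈ rel i
  exists_intersection_numbers : ∃ p : Fin (d + 1) → Fin (d + 1) → Fin (d + 1) → ℕ,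
    ∀ h i j x y, (x, y) ∈ rel h → {z | (x, z) ∈ rel i ∧ (z, y) ∈ rel j}.ncard = p h i j

namespace SymmetricAssociationScheme

open Matrix

noncomputable section

variable {X : Type*} {d : ℕ} (S : SymmetricAssociationScheme X d)

open scoped Classical in
/-- The adjacency matrix `A_i`. -/
def adj (i : Fin (d + 1)) : Matrix X X ℝ :=
  Matrix.of fun x y => if (x, y) ∈ S.rel i then 1 else 0

theorem adj_hadamard (i j : Fin (d + 1)) :
    S.adj i ⊙ S.adj j = if i = j then S.adj i else 0 := by
  ext x y
  by_cases hij : i = j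
  · subst hij
    simp [adj]
  · by_cases h : (x, y) ∈ S.rel i
    · have := Set.disjoint_left.1 (S.rel_disjoint i j hij) h
      simp [adj, hij, this]
    · simp [adj, hij, h]

theorem adj_transpose (i : Fin (d + 1)) : (S.adj i)ᵀ = S.adj i := by
  ext x y
  have : (y, x) ∈ S.rel i ↔ (x, y) ∈ S.rel i := ⟨S.rel_symm i y x, S.rel_symm i x y⟩
  simp only [adj, Matrix.transpose_apply, Matrix.of_apply]
  classical
  by_cases h : (x, y) ∈ S.rel i
  · rw [if_pos h, if_pos (this.2 h)]
  · rw [if_neg h, if_neg (mt this.1 h)]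

theorem adj_linearIndependent : LinearIndependent ℝ S.adj := by
  rw [Fintype.linearIndependent_iff]
  intro c hc i
  obtain ⟨⟨x, y⟩, hxy⟩ := S.rel_nonempty i
  have h := congrFun (congrFun hc x) y
  rw [Matrix.sum_apply, Finset.sum_eq_single i] at h
  · simpa [adj, hxy] using h
  · intro j _ hj
    have := Set.disjoint_left.1 (S.rel_disjoint i j hj.symm) hxy
    simp [adj, this]
  · simp

theorem adj_zero [DecidableEq X] : S.adj 0 = 1 := by
  ext x y
  simp [adj, S.rel_zero, Matrix.one_apply]

variable [Fintype X]

theorem adj_mul_mem (i j : Fin (d + 1)) :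
    S.adj i * S.adj j ∈ Submodule.span ℝ (Set.range S.adj) := by
  obtain ⟨p, hp⟩ := S.exists_intersection_numbers
  have : S.adj i * S.adj j = ∑ h, (p h i j : ℝ) • S.adj h := by
    ext x y
    obtain ⟨h, hh⟩ := Set.mem_iUnion.1 (S.rel_cover ▸ Set.mem_univ (x, y))
    rw [Matrix.sum_apply, Finset.sum_eq_single h, ← hp h i j x y hh]
    · classical
      simp only [Matrix.mul_apply, adj, Matrix.of_apply, Matrix.smul_apply, hh, if_true,
        smul_eq_mul, mul_one]
      rw [Set.ncard_eq_toFinset_card', Finset.card_eq_sum_ones, Set.toFinset_ofPred,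
        Finset.sum_filter]
      push_cast
      refine Finset.sum_congr rfl fun z _ => ?_
      by_cases h1 : (x, z) ∈ S.rel i <;> by_cases h2 : (z, y) ∈ S.rel j <;> simp [h1, h2]
    · intro k _ hk
      have := Set.disjoint_left.1 (S.rel_disjoint h k hk.symm) hh
      simp [adj, this]
    · simp
  rw [this]
  exact Submodule.sum_mem _ fun h _ =>
    Submodule.smul_mem _ _ (Submodule.subset_span ⟨h, rfl⟩)

variable [DecidableEq X]

/-- The Bose–Mesner algebra, the span of the adjacency matrices. -/
def boseMesner : Subalgebra ℝ (Matrix X X ℝ) :=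
  (Submodule.span ℝ (Set.range S.adj)).toSubalgebra
    (S.adj_zero ▸ Submodule.subset_span ⟨0, rfl⟩)
    (by
      intro A B hA hB
      induction hA, hB using Submodule.span_induction₂ with
      | mem_mem x y hx hy =>
        obtain ⟨i, rfl⟩ := hx
        obtain ⟨j, rfl⟩ := hy
        exact S.adj_mul_mem i j
      | zero_left y hy => simp
      | zero_right x hx => simp
      | add_left x y z _ _ _ h1 h2 => rw [add_mul]; exact Submodule.add_mem _ h1 h2
      | add_right x y z _ _ _ h1 h2 => rw [mul_add]; exact Submodule.add_mem _ h1 h2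
      | smul_left r x y _ _ h => rw [smul_mul_assoc]; exact Submodule.smul_mem _ _ h
      | smul_right r x y _ _ h => rw [mul_smul_comm]; exact Submodule.smul_mem _ _ h)

theorem mem_boseMesner {A : Matrix X X ℝ} :
    A ∈ S.boseMesner ↔ A ∈ Submodule.span ℝ (Set.range S.adj) := Iff.rfl

theorem adj_mem (i : Fin (d + 1)) : S.adj i ∈ S.boseMesner :=
  Submodule.subset_span ⟨i, rfl⟩

theorem hadamard_mem {A B : Matrix X X ℝ} (hA : A ∈ S.boseMesner) (hB : B ∈ S.boseMesner) :
    A ⊙ B ∈ S.boseMesner := by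
  rw [mem_boseMesner] at *
  induction hA, hB using Submodule.span_induction₂ with
  | mem_mem x y hx hy =>
    obtain ⟨i, rfl⟩ := hx
    obtain ⟨j, rfl⟩ := hy
    rw [adj_hadamard]
    split_ifs
    · exact S.adj_mem i
    · exact Submodule.zero_mem _
  | zero_left y hy => simp
  | zero_right x hx => simp
  | add_left x y z _ _ _ h1 h2 => rw [add_hadamard]; exact Submodule.add_mem _ h1 h2
  | add_right x y z _ _ _ h1 h2 => rw [hadamard_add]; exact Submodule.add_mem _ h1 h2
  | smul_left r x y _ _ h => rw [smul_hadamard]; exact Submodule.smul_mem _ _ h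
  | smul_right r x y _ _ h => rw [hadamard_smul]; exact Submodule.smul_mem _ _ h

theorem transpose_eq {A : Matrix X X ℝ} (hA : A ∈ S.boseMesner) : Aᵀ = A := by
  rw [mem_boseMesner] at hA
  induction hA using Submodule.span_induction with
  | mem x hx => obtain ⟨i, rfl⟩ := hx; exact S.adj_transpose i
  | zero => simp
  | add x y _ _ h1 h2 => rw [transpose_add, h1, h2]
  | smul r x _ h => rw [transpose_smul, h]

theorem comm {A B : Matrix X X ℝ} (hA : A ∈ S.boseMesner) (hB : B ∈ S.boseMesner) :
    A * B = B * A := by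
  rw [← S.transpose_eq (mul_mem hA hB), transpose_mul, S.transpose_eq hA, S.transpose_eq hB]

/-- The basis `A_0, …, A_d` of the Bose–Mesner algebra. -/
def adjBasis : Module.Basis (Fin (d + 1)) ℝ S.boseMesner :=
  Module.Basis.mk (v := fun i => (⟨S.adj i, S.adj_mem i⟩ : S.boseMesner))
    (LinearIndependent.of_comp S.boseMesner.val.toLinearMap S.adj_linearIndependent)
    (by
      rintro ⟨A, hA⟩ -
      rw [mem_boseMesner] at hA
      induction hA using Submodule.span_induction with
      | mem x hx => obtain ⟨i, rfl⟩ := hx; exact Submodule.subset_span ⟨i, rfl⟩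
      | zero => exact Submodule.zero_mem _
      | add x y hx hy h1 h2 => exact Submodule.add_mem _ (h1 hx) (h2 hy)
      | smul r x hx h => exact Submodule.smul_mem _ r (h hx))

/-- `E` is a primitive idempotent of the Bose–Mesner algebra: a nonzero idempotent that is minimal
among the nonzero idempotents of that algebra. -/
def IsPrimitiveIdempotent (E : Matrix X X ℝ) : Prop :=
  E ∈ S.boseMesner ∧ E ≠ 0 ∧ E * E = E ∧
    ∀ G ∈ S.boseMesner, G * G = G → E * G = G → G = 0 ∨ G = E

/-- The primitive idempotents of the scheme. -/
def PrimitiveIdempotent : Type _ := {E : Matrix X X ℝ // S.IsPrimitiveIdempotent E}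

variable {S} in
/-- A primitive idempotent as a matrix. -/
def PrimitiveIdempotent.mat (E : S.PrimitiveIdempotent) : Matrix X X ℝ := E.1

variable {S} in
/-- A primitive idempotent as an element of the Bose–Mesner algebra. -/
def PrimitiveIdempotent.elt (E : S.PrimitiveIdempotent) : S.boseMesner := ⟨E.1, E.2.1⟩

theorem PrimitiveIdempotent.mul_of_ne {E F : S.PrimitiveIdempotent} (h : E ≠ F) :
    E.mat * F.mat = 0 := by
  obtain ⟨E, hE, hE0, hEE, hEm⟩ := E
  obtain ⟨F, hF, hF0, hFF, hFm⟩ := F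
  change E * F = 0
  have hc := S.comm hE hF
  have hid : (E * F) * (E * F) = E * F := by
    rw [mul_assoc, ← mul_assoc F, ← hc, mul_assoc E F F, hFF, ← mul_assoc, hEE]
  rcases hEm _ (mul_mem hE hF) hid (by rw [← mul_assoc, hEE]) with h1 | h1
  · exact h1
  rcases hFm _ (mul_mem hE hF) hid (by rw [hc, ← mul_assoc, hFF]) with h2 | h2
  · exact h2
  exact absurd (Subtype.ext (h1.symm.trans h2)) h

theorem primitiveIdempotent_linearIndependent :
    LinearIndependent ℝ (PrimitiveIdempotent.elt (S := S)) := by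
  refine LinearIndependent.of_comp S.boseMesner.val.toLinearMap ?_
  rw [linearIndependent_iff']
  intro s c hc E hE
  have h := congrArg (fun M => M * E.mat) hc
  simp only [Finset.sum_mul, zero_mul] at h
  rw [Finset.sum_eq_single E] at h
  · have h' : c E • (E.mat * E.mat) = 0 := by rw [← smul_mul_assoc]; exact h
    have hEE : E.mat * E.mat = E.mat := E.2.2.2.1
    rw [hEE] at h'
    exact (smul_eq_zero.1 h').resolve_right E.2.2.1
  · intro F _ hF
    have := PrimitiveIdempotent.mul_of_ne S hF
    change (c F • F.mat) * E.mat = 0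
    rw [smul_mul_assoc, this, smul_zero]
  · exact fun h => absurd hE h

theorem idempotent_mem_span (G : Matrix X X ℝ) (hG : G ∈ S.boseMesner) (hGG : G * G = G) :
    G ∈ Submodule.span ℝ {E | S.IsPrimitiveIdempotent E} := by
  induction hR : LinearMap.range G.mulVecLin using WellFoundedLT.induction generalizing G with
  | _ R ih =>
  subst hR
  by_cases h0 : G = 0
  · rw [h0]; exact Submodule.zero_mem _
  by_cases hP : S.IsPrimitiveIdempotent G
  · exact Submodule.subset_span hP
  have : ∃ H ∈ S.boseMesner, H * H = H ∧ G * H = H ∧ H ≠ 0 ∧ H ≠ G := by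
    by_contra hcon
    push Not at hcon
    refine hP ⟨hG, h0, hGG, fun H hH hHH hGH => ?_⟩
    by_cases hH0 : H = 0
    · exact Or.inl hH0
    · exact Or.inr (hcon H hH hHH hGH hH0)
  obtain ⟨H, hH, hHH, hGH, hH0, hHG⟩ := this
  have key : ∀ K ∈ S.boseMesner, K * K = K → G * K = K → K ≠ G →
      K ∈ Submodule.span ℝ {E | S.IsPrimitiveIdempotent E} := by
    intro K hK hKK hGK hKG
    refine ih _ ?_ K hK hKK rfl
    refine lt_of_le_of_ne ?_ fun heq => hKG ?_
    · rintro _ ⟨v, rfl⟩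
      exact ⟨K *ᵥ v, by simp [hGK]⟩
    · have hKG' : K * G = G := by
        refine Matrix.ext_of_mulVec_single fun i => ?_
        have hv : G *ᵥ Pi.single i 1 ∈ LinearMap.range K.mulVecLin :=
          heq ▸ ⟨Pi.single i 1, rfl⟩
        obtain ⟨w, hw⟩ := hv
        rw [Matrix.mulVecLin_apply] at hw
        rw [← Matrix.mulVec_mulVec, ← hw, Matrix.mulVec_mulVec, hKK]
      rw [← hGK, S.comm hG hK, hKG']
  have hHG' : H * G = H := by rw [S.comm hH hG, hGH]
  have h2 := key (G - H) (sub_mem hG hH)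
    (by rw [sub_mul, mul_sub, mul_sub, hGG, hGH, hHG', hHH]; abel)
    (by rw [mul_sub, hGG, hGH]) (by simpa using hH0)
  have := Submodule.add_mem _ (key H hH hHH hGH hHG) h2
  simpa using this


theorem mem_span_primitive {A : Matrix X X ℝ} (hA : A ∈ S.boseMesner) :
    A ∈ Submodule.span ℝ {E | S.IsPrimitiveIdempotent E} := by
  have hsa : IsSelfAdjoint A := by
    rw [IsSelfAdjoint, Matrix.star_eq_conjTranspose, Matrix.conjTranspose_eq_transpose_of_trivial,
      S.transpose_eq hA]
  have hfin : (spectrum ℝ A).Finite := Matrix.finite_real_spectrum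
  have hzero : ∀ p : Polynomial ℝ, (∀ x ∈ spectrum ℝ A, p.eval x = 0) →
      Polynomial.aeval A p = 0 := by
    intro p hp
    rw [← cfc_polynomial p A hsa, ← cfc_zero ℝ A]
    exact cfc_congr fun x hx => hp x hx
  have hmem : ∀ p : Polynomial ℝ, Polynomial.aeval A p ∈ S.boseMesner := fun p =>
    (Algebra.adjoin_le (Set.singleton_subset_iff.2 hA)) (Polynomial.aeval_mem_adjoin_singleton ℝ A)
  let s : Finset ℝ := hfin.toFinset
  have hs : ∀ x, x ∈ s ↔ x ∈ spectrum ℝ A := fun x => hfin.mem_toFinset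
  have hinj : Set.InjOn (id : ℝ → ℝ) s := Function.injective_id.injOn
  have heval : ∀ a ∈ s, ∀ x ∈ s, (Lagrange.basis s id a).eval x = if a = x then 1 else 0 := by
    intro a ha x hx
    split_ifs with h
    · subst h; exact Lagrange.eval_basis_self hinj ha
    · exact Lagrange.eval_basis_of_ne (v := id) h hx
  have hsum : A = ∑ a ∈ s, a • Polynomial.aeval A (Lagrange.basis s id a) := by
    have h := hzero (Polynomial.X - ∑ a ∈ s, a • Lagrange.basis s id a) (by
      intro x hx
      rw [Polynomial.eval_sub, Polynomial.eval_X, Polynomial.eval_finsetSum,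
        Finset.sum_eq_single x]
      · rw [Polynomial.eval_smul, heval x ((hs x).2 hx) x ((hs x).2 hx)]; simp
      · intro a ha hax
        rw [Polynomial.eval_smul, heval a ha x ((hs x).2 hx)]; simp [hax]
      · exact fun h => absurd ((hs x).2 hx) h)
    rw [map_sub, Polynomial.aeval_X, map_sum, sub_eq_zero] at h
    simpa only [map_smul] using h
  rw [hsum]
  refine Submodule.sum_mem _ fun a ha => Submodule.smul_mem _ _ ?_
  refine S.idempotent_mem_span _ (hmem _) ?_
  have h := hzero (Lagrange.basis s id a * Lagrange.basis s id a - Lagrange.basis s id a) (by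
    intro x hx
    rw [Polynomial.eval_sub, Polynomial.eval_mul, heval a ha x ((hs x).2 hx)]
    split_ifs <;> simp)
  rwa [map_sub, map_mul, sub_eq_zero] at h

/-- The basis of the Bose–Mesner algebra that consists of the primitive idempotents. -/
def idempotentBasis : Module.Basis S.PrimitiveIdempotent ℝ S.boseMesner :=
  Module.Basis.mk S.primitiveIdempotent_linearIndependent
    (by
      rintro ⟨A, hA⟩ -
      have h := S.mem_span_primitive hA
      have hmap : {E | S.IsPrimitiveIdempotent E} =
          S.boseMesner.val.toLinearMap '' Set.range (PrimitiveIdempotent.elt (S := S)) := by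
        ext E
        constructor
        · exact fun hE => ⟨⟨E, hE.1⟩, ⟨⟨E, hE⟩, rfl⟩, rfl⟩
        · rintro ⟨_, ⟨G, rfl⟩, rfl⟩
          exact G.2
      rw [hmap, Submodule.span_image] at h
      obtain ⟨B, hB, hBA⟩ := h
      have : B = ⟨A, hA⟩ := Subtype.ext hBA
      exact this ▸ hB)

/-- The eigenvalue of `A_i` for the primitive idempotent `F`: the coefficient of `F` when
`A_i` is expanded in the basis of primitive idempotents. -/
def eigenvalue (i : Fin (d + 1)) (F : S.PrimitiveIdempotent) : ℝ :=
  S.idempotentBasis.repr ⟨S.adj i, S.adj_mem i⟩ F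

/-- The dual eigenvalue `θ*_i` of `E` for `A_i`: `E = |X|⁻¹ ∑ i, θ*_i • A_i`. -/
def dualEigenvalue (E : S.PrimitiveIdempotent) (i : Fin (d + 1)) : ℝ :=
  Fintype.card X * S.adjBasis.repr E.elt i

/-- The Krein parameter `q^H_{E,F}`: the entrywise product of `E` and `F` equals
`|X|⁻¹ ∑ H, q^H_{E,F} • H`, where `H` runs over the primitive idempotents. -/
def krein (H E F : S.PrimitiveIdempotent) : ℝ :=
  Fintype.card X * S.idempotentBasis.repr ⟨E.mat ⊙ F.mat, S.hadamard_mem E.2.1 F.2.1⟩ H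

variable {S} in
/-- The trivial primitive idempotent is `|X|⁻¹ J`, with `J` the all-ones matrix. -/
def PrimitiveIdempotent.IsTrivial (E : S.PrimitiveIdempotent) : Prop :=
  E.mat = (Fintype.card X : ℝ)⁻¹ • Matrix.of fun _ _ => 1

/-- The enumeration `E_0, E_1, …, E_d` of the primitive idempotents starts with the trivial one,
and the ordering `E_1, …, E_d` of the nontrivial ones is `Q`-polynomial: `q^1_{ij}` vanishes if
`|i - j| > 1` and does not vanish if `|i - j| = 1`. -/
def IsQPolynomialOrdering (e : Fin (d + 1) ≃ S.PrimitiveIdempotent) : Prop :=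
  (e 0).IsTrivial ∧ ∀ i j : Fin (d + 1),
    (1 < |(i : ℤ) - (j : ℤ)| → S.krein (e 1) (e i) (e j) = 0) ∧
    (|(i : ℤ) - (j : ℤ)| = 1 → S.krein (e 1) (e i) (e j) ≠ 0)

/-- The scheme is `Q`-polynomial relative to `E`, and `F` is the last primitive idempotent in this
`Q`-polynomial structure. -/
def IsQPolynomialWithLast (E F : S.PrimitiveIdempotent) : Prop :=
  ∃ e : Fin (d + 1) ≃ S.PrimitiveIdempotent,
    S.IsQPolynomialOrdering e ∧ e 1 = E ∧ e (Fin.last d) = F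

end

end SymmetricAssociationScheme

/-! Reading a matrix of the Bose–Mesner algebra through its coordinates in A_0, …, A_d turns
entrywise products into pointwise products and |X| E into the function θ*. Let B be the matrix of
entrywise multiplication by |X| E in the basis of primitive idempotents. The coefficient of H in
θ*^r then has two expressions: |X| times the (E₀, H) entry of B^r
(`idempotentCoeff_dualEigenvalue_pow`), and the sum of θ*_i^r times the eigenvalue of A_i for H
(`idempotentCoeff_eq_sum`).

For a Q-polynomial ordering, B is tridiagonal, so the coefficient of E_j kills polynomials in θ* of
degree below j and takes one nonzero value on all monic ones of degree j. Suitable products of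
factors X - θ*_k then force the θ*_k to be distinct and determine the eigenvalues for E_d.

Conversely, the formula in (ii) says that the eigenvalues for F are a multiple of the Lagrange
weights of the θ*_i. Hence F has coefficient zero in θ*^r for r < d, and nonzero for r = d. Since B
is nonnegative (`krein_nonneg`), F lies at distance d from E₀ in the directed graph of nonzero
entries of B. That graph has d + 1 vertices, so a shortest path meets each of them once and has no
forward chords: it is the Q-polynomial ordering. -/

section NonnegativeMatrix

/-! ### Walks along the nonzero entries of a matrix. -/

theorem Matrix.mul_apply_pos {ι : Type*} [Fintype ι] {A B : Matrix ι ι ℝ}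
    (hA : ∀ i j, 0 ≤ A i j) (hB : ∀ i j, 0 ≤ B i j)
    {i j k : ι} (hij : 0 < A i j) (hjk : 0 < B j k) : 0 < (A * B) i k := by
  rw [Matrix.mul_apply]
  exact (mul_pos hij hjk).trans_le (Finset.single_le_sum (f := fun l => A i l * B l k)
    (fun l _ => mul_nonneg (hA i l) (hB l k)) (Finset.mem_univ j))

variable {ι : Type*} [Fintype ι] [DecidableEq ι] {B : Matrix ι ι ℝ}

/-- A nonzero entry of `B ^ r` comes from a walk of length `r` along nonzero entries of `B`. -/
theorem Matrix.exists_walk_of_pow_apply_ne_zero {r : ℕ} {a b : ι} (h : (B ^ r) a b ≠ 0) :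
    ∃ v : ℕ → ι, v 0 = a ∧ v r = b ∧ ∀ k < r, B (v k) (v (k + 1)) ≠ 0 := by
  induction r generalizing b with
  | zero =>
    have hab : a = b := by
      by_contra hab
      exact h (by rw [pow_zero, Matrix.one_apply_ne hab])
    exact ⟨fun _ => a, rfl, hab, by simp⟩
  | succ r ih =>
    rw [pow_succ, Matrix.mul_apply] at h
    obtain ⟨c, -, hc⟩ := Finset.exists_ne_zero_of_sum_ne_zero h
    obtain ⟨v, hv0, hvr, hv⟩ := ih (left_ne_zero_of_mul hc)
    refine ⟨fun k => if k ≤ r then v k else b, by simpa using hv0, by simp, fun k hk => ?_⟩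
    rcases Nat.lt_succ_iff_lt_or_eq.1 hk with hk' | rfl
    · simpa [hk'.le, Nat.succ_le_of_lt hk'] using hv k hk'
    · simpa [hvr] using right_ne_zero_of_mul hc

theorem Matrix.pow_apply_pos_of_walk (hB : ∀ i j, 0 ≤ B i j) {r : ℕ} {v : ℕ → ι}
    (hv : ∀ k < r, B (v k) (v (k + 1)) ≠ 0) (i k : ℕ) (hik : i + k ≤ r) :
    0 < (B ^ k) (v i) (v (i + k)) := by
  induction k with
  | zero => simp
  | succ k ih =>
    rw [pow_succ]
    exact Matrix.mul_apply_pos (Matrix.pow_apply_nonneg hB k) hB (ih (by omega))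
      ((hB _ _).lt_of_ne' (hv (i + k) (by omega)))

/-- In a nonnegative matrix, a walk of minimal length has no repeated vertices and no chords. -/
theorem Matrix.walk_of_minimal_length (hB : ∀ i j, 0 ≤ B i j) {r : ℕ} {v : ℕ → ι}
    (hv : ∀ k < r, B (v k) (v (k + 1)) ≠ 0) (hmin : ∀ s < r, (B ^ s) (v 0) (v r) = 0)
    {i j : ℕ} (hij : i < j) (hj : j ≤ r) :
    v i ≠ v j ∧ (i + 1 < j → B (v i) (v j) = 0) := by
  have h1 : 0 < (B ^ i) (v 0) (v i) := by
    simpa using Matrix.pow_apply_pos_of_walk hB hv 0 i (by omega)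
  have h2 : 0 < (B ^ (r - j)) (v j) (v r) := by
    simpa [Nat.add_sub_cancel' hj] using Matrix.pow_apply_pos_of_walk hB hv j (r - j) (by omega)
  have hn := Matrix.pow_apply_nonneg hB
  constructor
  -- A repeated vertex lets the loop be cut out, leaving a walk of length i + (r - j) < r.
  · intro h
    have h3 := Matrix.mul_apply_pos (hn i) (hn (r - j)) (h ▸ h1) h2
    rw [← pow_add, hmin _ (by omega)] at h3
    exact h3.false
  -- A chord gives a shortcut of length i + 1 + (r - j) < r.
  · intro hlt
    by_contra h
    have h3 := Matrix.mul_apply_pos (hn i) hB h1 ((hB _ _).lt_of_ne' h)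
    rw [← pow_succ] at h3
    have h4 := Matrix.mul_apply_pos (hn _) (hn (r - j)) h3 h2
    rw [← pow_add, hmin _ (by omega)] at h4
    exact h4.false

end NonnegativeMatrix

/-- Powers of a matrix that raises the index by at most one: the entry of `B ^ r` at `(e 0, e j)`
vanishes for `r < j`, and does not vanish for `r = j`. -/
theorem Matrix.pow_apply_of_tridiagonal {ι : Type*} [Fintype ι] [DecidableEq ι]
    {B : Matrix ι ι ℝ} {d : ℕ} (e : Fin (d + 1) ≃ ι)
    (h0 : ∀ i j : Fin (d + 1), (i : ℕ) + 1 < j → B (e i) (e j) = 0)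
    (h1 : ∀ i j : Fin (d + 1), (i : ℕ) + 1 = j → B (e i) (e j) ≠ 0) (r : ℕ) (j : Fin (d + 1)) :
    (r < (j : ℕ) → (B ^ r) (e 0) (e j) = 0) ∧ (r = (j : ℕ) → (B ^ r) (e 0) (e j) ≠ 0) := by
  induction r generalizing j with
  | zero =>
    rw [pow_zero]
    refine ⟨fun h => Matrix.one_apply_ne fun he => ?_, fun h => ?_⟩
    · rw [← e.injective he] at h; simp at h
    · have : j = 0 := Fin.ext h.symm
      subst this
      rw [Matrix.one_apply_eq]
      exact one_ne_zero
  | succ r ih =>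
    rw [pow_succ, Matrix.mul_apply, ← e.sum_comp]
    refine ⟨fun h => Finset.sum_eq_zero fun k _ => ?_, fun h => ?_⟩
    · rcases lt_or_ge r (k : ℕ) with hk | hk
      · rw [(ih k).1 hk, zero_mul]
      · rw [h0 k j (by omega), mul_zero]
    · have hr : r < d + 1 := by omega
      -- Only k = r contributes: from k < r the last step would jump too far, and k > r is not
      -- reached in r steps.
      rw [Finset.sum_eq_single ⟨r, hr⟩]
      · exact mul_ne_zero ((ih ⟨r, hr⟩).2 rfl) (h1 _ _ h)
      · intro k _ hk
        have hk' : (k : ℕ) ≠ r := fun h => hk (Fin.ext h)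
        rcases lt_or_gt_of_ne hk' with hk | hk
        · rw [h0 k j (by omega), mul_zero]
        · rw [(ih k).1 hk, zero_mul]
      · simp

/-! ### Sign and symmetry of the Krein parameters. -/

namespace SymmetricAssociationScheme

open Matrix Polynomial

noncomputable section

variable {X : Type*} {d : ℕ} (S : SymmetricAssociationScheme X d) [Fintype X] [DecidableEq X]

instance : Fintype S.PrimitiveIdempotent :=
  Fintype.ofEquiv _ (S.adjBasis.indexEquiv S.idempotentBasis)

open scoped Classical in
instance : DecidableEq S.PrimitiveIdempotent := inferInstance

theorem card_primitiveIdempotent : Fintype.card S.PrimitiveIdempotent = d + 1 := by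
  rw [← Fintype.card_congr (S.adjBasis.indexEquiv S.idempotentBasis), Fintype.card_fin]

theorem card_ne_zero {X : Type*} {d : ℕ} (S : SymmetricAssociationScheme X d) [Fintype X] :
    (Fintype.card X : ℝ) ≠ 0 := by
  obtain ⟨⟨x, -⟩, -⟩ := S.rel_nonempty 0
  have : Nonempty X := ⟨x⟩
  exact_mod_cast Fintype.card_ne_zero

@[simp]
theorem idempotentBasis_apply (E : S.PrimitiveIdempotent) : S.idempotentBasis E = E.elt :=
  Module.Basis.mk_apply _ _ _

@[simp]
theorem coe_adjBasis_apply (i : Fin (d + 1)) : (S.adjBasis i : Matrix X X ℝ) = S.adj i := by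
  rw [adjBasis, Module.Basis.mk_apply]

theorem PrimitiveIdempotent.mat_mul_self (E : S.PrimitiveIdempotent) : E.mat * E.mat = E.mat :=
  E.2.2.2.1

theorem PrimitiveIdempotent.mat_transpose (E : S.PrimitiveIdempotent) : E.matᵀ = E.mat :=
  S.transpose_eq E.2.1

theorem mul_primitiveIdempotent (A : S.boseMesner) (H : S.PrimitiveIdempotent) :
    (A : Matrix X X ℝ) * H.mat = S.idempotentBasis.repr A H • H.mat := by
  have h : (A : Matrix X X ℝ) = ∑ G, S.idempotentBasis.repr A G • G.mat := by
    conv_lhs => rw [← S.idempotentBasis.sum_repr A]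
    simp only [idempotentBasis_apply, AddSubmonoidClass.coe_finsetSum, SetLike.val_smul]
    rfl
  rw [h, Finset.sum_mul, Finset.sum_eq_single H]
  · rw [smul_mul_assoc, H.mat_mul_self]
  · intro G _ hG
    rw [smul_mul_assoc, PrimitiveIdempotent.mul_of_ne S hG, smul_zero]
  · simp

theorem trace_pos (H : S.PrimitiveIdempotent) : 0 < H.mat.trace := by
  have h : H.mat.trace = ∑ x, ∑ y, H.mat x y ^ 2 := by
    conv_lhs => rw [← H.mat_mul_self]
    refine Finset.sum_congr rfl fun x _ => ?_
    rw [Matrix.diag_apply, Matrix.mul_apply]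
    refine Finset.sum_congr rfl fun y _ => ?_
    have : H.mat y x = H.mat x y := congrFun (congrFun H.mat_transpose x) y
    rw [this, sq]
  rw [h]
  refine lt_of_le_of_ne (by positivity) fun h0 => H.2.2.1 ?_
  ext x y
  have hx := (Finset.sum_eq_zero_iff_of_nonneg (fun x _ => by positivity)).1 h0.symm x
    (Finset.mem_univ _)
  have hy := (Finset.sum_eq_zero_iff_of_nonneg (fun y _ => by positivity)).1 hx y
    (Finset.mem_univ _)
  exact pow_eq_zero_iff two_ne_zero |>.1 hy

/-- The sum of the entries of `E ∘ G ∘ H`. -/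
def tripleSum (E G H : Matrix X X ℝ) : ℝ := ∑ x, ∑ y, E x y * G x y * H x y

/-- Multiply E ∘ G by H and take traces. The right side is symmetric in E, G, H and the trace of H
is positive, so both the sign and the vanishing of Krein parameters can be read off `tripleSum`. -/
theorem krein_mul_trace (H E G : S.PrimitiveIdempotent) :
    S.krein H E G * H.mat.trace = Fintype.card X * tripleSum E.mat G.mat H.mat := by
  have h := congrArg Matrix.trace (S.mul_primitiveIdempotent
    ⟨E.mat ⊙ G.mat, S.hadamard_mem E.2.1 G.2.1⟩ H)
  rw [Matrix.trace_smul, smul_eq_mul] at h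
  rw [krein, mul_assoc, ← h]
  congr 1
  refine Finset.sum_congr rfl fun x _ => ?_
  rw [Matrix.diag_apply, Matrix.mul_apply]
  refine Finset.sum_congr rfl fun y _ => ?_
  have : H.mat y x = H.mat x y := congrFun (congrFun H.mat_transpose x) y
  rw [this]
  rfl

/-- This is the Krein condition. A symmetric idempotent is the Gram matrix of its own rows, so an
entrywise product of three is the Gram matrix of their tensor products; the sum of its entries is a
squared norm. -/
theorem tripleSum_nonneg (E G H : S.PrimitiveIdempotent) :
    0 ≤ tripleSum E.mat G.mat H.mat := by
  have key : ∀ (P : S.PrimitiveIdempotent) x y, P.mat x y = ∑ a, P.mat x a * P.mat y a := by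
    intro P x y
    conv_lhs => rw [← P.mat_mul_self, Matrix.mul_apply]
    refine Finset.sum_congr rfl fun a _ => ?_
    have : P.mat a y = P.mat y a := congrFun (congrFun P.mat_transpose y) a
    rw [this]
  have h : tripleSum E.mat G.mat H.mat =
      ∑ a, ∑ b, ∑ c, (∑ x, E.mat x a * G.mat x b * H.mat x c) ^ 2 := by
    have hl : ∀ x y, E.mat x y * G.mat x y * H.mat x y = ∑ a, ∑ b, ∑ c,
        (E.mat x a * G.mat x b * H.mat x c) * (E.mat y a * G.mat y b * H.mat y c) := by
      intro x y
      rw [key E x y, key G x y, key H x y, Finset.sum_mul_sum, Finset.sum_mul]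
      refine Finset.sum_congr rfl fun a _ => ?_
      rw [Finset.sum_mul_sum]
      refine Finset.sum_congr rfl fun b _ => Finset.sum_congr rfl fun c _ => by ring
    simp only [tripleSum, hl, sq, Finset.sum_mul_sum]
    calc _ = ∑ x, ∑ a, ∑ b, ∑ c, ∑ y,
          (E.mat x a * G.mat x b * H.mat x c) * (E.mat y a * G.mat y b * H.mat y c) := by
            refine Finset.sum_congr rfl fun x _ => ?_
            rw [Finset.sum_comm]
            refine Finset.sum_congr rfl fun a _ => ?_
            rw [Finset.sum_comm]
            refine Finset.sum_congr rfl fun b _ => ?_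
            rw [Finset.sum_comm]
      _ = _ := by
            rw [Finset.sum_comm]
            refine Finset.sum_congr rfl fun a _ => ?_
            rw [Finset.sum_comm]
            refine Finset.sum_congr rfl fun b _ => ?_
            rw [Finset.sum_comm]
  rw [h]
  positivity

theorem krein_nonneg (H E G : S.PrimitiveIdempotent) : 0 ≤ S.krein H E G := by
  have h := S.krein_mul_trace H E G
  have h' : 0 ≤ S.krein H E G * H.mat.trace :=
    h ▸ mul_nonneg (Nat.cast_nonneg _) (S.tripleSum_nonneg E G H)
  exact nonneg_of_mul_nonneg_left h' (S.trace_pos H)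

theorem krein_eq_zero_iff (H E G : S.PrimitiveIdempotent) :
    S.krein H E G = 0 ↔ tripleSum E.mat G.mat H.mat = 0 := by
  have h := S.krein_mul_trace H E G
  constructor
  · intro h0
    rw [h0, zero_mul] at h
    exact (mul_eq_zero.1 h.symm).resolve_left S.card_ne_zero
  · intro h0
    rw [h0, mul_zero] at h
    exact (mul_eq_zero.1 h).resolve_right (S.trace_pos H).ne'

theorem krein_eq_zero_rotate (H E G : S.PrimitiveIdempotent) :
    S.krein H E G = 0 ↔ S.krein E G H = 0 := by
  rw [krein_eq_zero_iff, krein_eq_zero_iff]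
  have : tripleSum E.mat G.mat H.mat = tripleSum G.mat H.mat E.mat :=
    Finset.sum_congr rfl fun x _ => Finset.sum_congr rfl fun y _ => by ring
  rw [this]

theorem krein_comm (H E G : S.PrimitiveIdempotent) : S.krein H E G = S.krein H G E := by
  have := Matrix.hadamard_comm E.mat G.mat
  simp only [krein, this]

/-! ### Coordinates, and powers of the dual eigenvalue function. -/

/-- The element of the Bose–Mesner algebra with the given coordinates with respect to
`A_0, …, A_d`. Pointwise products of coordinates correspond to entrywise products of matrices. -/
def ofCoord : (Fin (d + 1) → ℝ) ≃ₗ[ℝ] S.boseMesner := S.adjBasis.equivFun.symm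

theorem coe_ofCoord (f : Fin (d + 1) → ℝ) :
    (S.ofCoord f : Matrix X X ℝ) = ∑ i, f i • S.adj i := by
  simp [ofCoord, Module.Basis.equivFun_symm_apply]

theorem ofCoord_apply_of_mem (f : Fin (d + 1) → ℝ) {x y : X} {i : Fin (d + 1)}
    (h : (x, y) ∈ S.rel i) : (S.ofCoord f : Matrix X X ℝ) x y = f i := by
  rw [coe_ofCoord, Matrix.sum_apply, Finset.sum_eq_single i]
  · simp [adj, h]
  · intro j _ hj
    have := Set.disjoint_left.1 (S.rel_disjoint i j hj.symm) h
    simp [adj, this]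
  · simp

theorem ofCoord_mul (f g : Fin (d + 1) → ℝ) :
    (S.ofCoord (f * g) : Matrix X X ℝ) = (S.ofCoord f : Matrix X X ℝ) ⊙ S.ofCoord g := by
  ext x y
  obtain ⟨i, hi⟩ := Set.mem_iUnion.1 (S.rel_cover ▸ Set.mem_univ (x, y))
  simp [S.ofCoord_apply_of_mem _ hi]

theorem ofCoord_one : (S.ofCoord 1 : Matrix X X ℝ) = Matrix.of fun _ _ => 1 := by
  ext x y
  obtain ⟨i, hi⟩ := Set.mem_iUnion.1 (S.rel_cover ▸ Set.mem_univ (x, y))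
  simp [S.ofCoord_apply_of_mem _ hi]

theorem ofCoord_dualEigenvalue (E : S.PrimitiveIdempotent) :
    S.ofCoord (S.dualEigenvalue E) = (Fintype.card X : ℝ) • E.elt := by
  have h : S.dualEigenvalue E = (Fintype.card X : ℝ) • S.adjBasis.equivFun E.elt := rfl
  rw [h, map_smul, ofCoord, LinearEquiv.symm_apply_apply]

/-- The coefficient of `H` in the matrix with the given coordinates. -/
def idempotentCoeff (H : S.PrimitiveIdempotent) : (Fin (d + 1) → ℝ) →ₗ[ℝ] ℝ :=
  S.idempotentBasis.coord H ∘ₗ S.ofCoord.toLinearMap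

theorem idempotentCoeff_apply (H : S.PrimitiveIdempotent) (f : Fin (d + 1) → ℝ) :
    S.idempotentCoeff H f = S.idempotentBasis.repr (S.ofCoord f) H := rfl

theorem idempotentCoeff_single (H : S.PrimitiveIdempotent) (i : Fin (d + 1)) :
    S.idempotentCoeff H (Pi.single i 1) = S.eigenvalue i H := by
  have : S.ofCoord (Pi.single i 1) = ⟨S.adj i, S.adj_mem i⟩ :=
    Subtype.ext (by rw [coe_ofCoord]; simp [Pi.single_apply])
  rw [idempotentCoeff_apply, this, eigenvalue]

theorem idempotentCoeff_eq_sum (H : S.PrimitiveIdempotent) (f : Fin (d + 1) → ℝ) :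
    S.idempotentCoeff H f = ∑ i, f i * S.eigenvalue i H := by
  conv_lhs => rw [pi_eq_sum_univ' f, map_sum]
  refine Finset.sum_congr rfl fun i _ => ?_
  rw [map_smul, smul_eq_mul, ← idempotentCoeff_single]

theorem eigenvalue_zero (H : S.PrimitiveIdempotent) : S.eigenvalue 0 H = 1 := by
  have h := S.mul_primitiveIdempotent ⟨S.adj 0, S.adj_mem 0⟩ H
  simp only [S.adj_zero, one_mul] at h
  have h' : (S.eigenvalue 0 H - 1) • H.mat = 0 := by
    rw [sub_smul, one_smul, sub_eq_zero]
    simpa only [eigenvalue, S.adj_zero] using h.symm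
  exact sub_eq_zero.1 ((smul_eq_zero.1 h').resolve_right H.2.2.1)

/-- The matrix that represents entrywise multiplication by `|X| E` in the basis of primitive
idempotents. -/
def kreinMatrix (E : S.PrimitiveIdempotent) :
    Matrix S.PrimitiveIdempotent S.PrimitiveIdempotent ℝ :=
  Matrix.of fun G H => S.krein H E G

theorem idempotentCoeff_dualEigenvalue_mul (E H : S.PrimitiveIdempotent)
    (f : Fin (d + 1) → ℝ) :
    S.idempotentCoeff H (S.dualEigenvalue E * f) =
      ∑ G, S.idempotentCoeff G f * S.kreinMatrix E G H := by
  have hf : f = ∑ G, S.idempotentCoeff G f • S.ofCoord.symm G.elt := by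
    apply S.ofCoord.injective
    simp only [map_sum, map_smul, LinearEquiv.apply_symm_apply]
    conv_lhs => rw [← S.idempotentBasis.sum_repr (S.ofCoord f)]
    simp only [idempotentBasis_apply]
    rfl
  conv_lhs => rw [hf, Finset.mul_sum, map_sum]
  refine Finset.sum_congr rfl fun G _ => ?_
  rw [mul_smul_comm, map_smul, smul_eq_mul]
  congr 1
  have h : S.ofCoord (S.dualEigenvalue E * S.ofCoord.symm G.elt) =
      (Fintype.card X : ℝ) • ⟨E.mat ⊙ G.mat, S.hadamard_mem E.2.1 G.2.1⟩ := by
    apply Subtype.ext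
    rw [ofCoord_mul, ofCoord_dualEigenvalue, LinearEquiv.apply_symm_apply]
    exact Matrix.smul_hadamard E.mat G.mat _
  rw [idempotentCoeff_apply, h, map_smul]
  rfl

theorem idempotentCoeff_one {E₀ : S.PrimitiveIdempotent} (h₀ : E₀.IsTrivial)
    (H : S.PrimitiveIdempotent) :
    S.idempotentCoeff H 1 = if E₀ = H then (Fintype.card X : ℝ) else 0 := by
  have h : S.ofCoord 1 = (Fintype.card X : ℝ) • S.idempotentBasis E₀ := by
    apply Subtype.ext
    rw [ofCoord_one, idempotentBasis_apply]
    change _ = (Fintype.card X : ℝ) • E₀.mat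
    rw [h₀, smul_smul, mul_inv_cancel₀ S.card_ne_zero, one_smul]
  rw [idempotentCoeff_apply, h, map_smul, Module.Basis.repr_self]
  simp [Finsupp.single_apply]

/-- The constant function 1 is J = |X| E₀, and each factor θ* multiplies the row vector of
coefficients by `kreinMatrix E`. -/
theorem idempotentCoeff_dualEigenvalue_pow (E : S.PrimitiveIdempotent)
    {E₀ : S.PrimitiveIdempotent} (h₀ : E₀.IsTrivial) (H : S.PrimitiveIdempotent) (r : ℕ) :
    S.idempotentCoeff H (S.dualEigenvalue E ^ r) =
      Fintype.card X * (S.kreinMatrix E ^ r) E₀ H := by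
  induction r generalizing H with
  | zero => rw [pow_zero, pow_zero, idempotentCoeff_one S h₀, Matrix.one_apply]; simp
  | succ r ih =>
    rw [pow_succ', idempotentCoeff_dualEigenvalue_mul, pow_succ, Matrix.mul_apply, Finset.mul_sum]
    exact Finset.sum_congr rfl fun G _ => by rw [ih, mul_assoc]

theorem idempotentCoeff_eval (E : S.PrimitiveIdempotent) {E₀ : S.PrimitiveIdempotent}
    (h₀ : E₀.IsTrivial) (H : S.PrimitiveIdempotent) (p : ℝ[X]) :
    S.idempotentCoeff H (fun i => p.eval (S.dualEigenvalue E i)) =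
      ∑ r ∈ Finset.range (p.natDegree + 1),
        p.coeff r * (Fintype.card X * (S.kreinMatrix E ^ r) E₀ H) := by
  have : (fun i => p.eval (S.dualEigenvalue E i)) =
      ∑ r ∈ Finset.range (p.natDegree + 1), p.coeff r • S.dualEigenvalue E ^ r := by
    ext i
    simp [Polynomial.eval_eq_sum_range]
  rw [this, map_sum]
  exact Finset.sum_congr rfl fun r _ => by
    rw [map_smul, smul_eq_mul, S.idempotentCoeff_dualEigenvalue_pow E h₀]

/-- Minimality comes from J having rank one: J G J is always a multiple of J, so an idempotent below
|X|⁻¹ J is c |X|⁻¹ J with c² = c. -/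
theorem exists_isTrivial : ∃ E₀ : S.PrimitiveIdempotent, E₀.IsTrivial := by
  have hn := S.card_ne_zero
  let J : Matrix X X ℝ := Matrix.of fun _ _ => 1
  have hJGJ : ∀ G : Matrix X X ℝ, J * G * J = (∑ x, ∑ y, G x y) • J := by
    intro G
    ext x y
    simp only [Matrix.mul_apply, J, Matrix.of_apply, one_mul, mul_one, Matrix.smul_apply,
      smul_eq_mul]
    exact Finset.sum_comm
  have hJJ : J * J = (Fintype.card X : ℝ) • J := by
    ext x y
    simp [Matrix.mul_apply, J]
  have hJ : J ∈ S.boseMesner := by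
    simpa only [ofCoord_one] using (S.ofCoord 1).2
  have hE : (Fintype.card X : ℝ)⁻¹ • J ∈ S.boseMesner := Subalgebra.smul_mem _ hJ _
  have hEE : ((Fintype.card X : ℝ)⁻¹ • J) * ((Fintype.card X : ℝ)⁻¹ • J) =
      (Fintype.card X : ℝ)⁻¹ • J := by
    rw [smul_mul_smul_comm, hJJ, smul_smul]
    congr 1
    field_simp
  have hE0 : (Fintype.card X : ℝ)⁻¹ • J ≠ 0 := by
    obtain ⟨⟨x, y⟩, -⟩ := S.rel_nonempty 0
    intro h
    have := congrFun (congrFun h x) y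
    simp only [Matrix.smul_apply, J, Matrix.of_apply, smul_eq_mul, mul_one,
      Matrix.zero_apply] at this
    exact inv_ne_zero hn this
  refine ⟨⟨(Fintype.card X : ℝ)⁻¹ • J, hE, hE0, hEE, fun G hG hGG hEG => ?_⟩, rfl⟩
  obtain ⟨c, hc⟩ : ∃ c : ℝ, G = c • ((Fintype.card X : ℝ)⁻¹ • J) := by
    have h : G = ((Fintype.card X : ℝ)⁻¹ • J) * G * ((Fintype.card X : ℝ)⁻¹ • J) := by
      rw [hEG, S.comm hG hE, hEG]
    refine ⟨(Fintype.card X : ℝ)⁻¹ * ∑ x, ∑ y, G x y, ?_⟩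
    conv_lhs => rw [h]
    rw [smul_mul_assoc, smul_mul_smul_comm, hJGJ, smul_smul, smul_smul]
    congr 1
    ring
  have hcc : (c * c - c) • ((Fintype.card X : ℝ)⁻¹ • J) = 0 := by
    rw [sub_smul, sub_eq_zero, ← hc]
    conv_rhs => rw [← hGG, hc, smul_mul_smul_comm, hEE]
  have hc' : c * (c - 1) = 0 := by
    rw [mul_sub, mul_one]
    exact (smul_eq_zero.1 hcc).resolve_right hE0
  rcases mul_eq_zero.1 hc' with h | h
  · left; rw [hc, h, zero_smul]
  · right; rw [hc, sub_eq_zero.1 h, one_smul]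

/-- Multiplying the trivial primitive idempotent entrywise by `|X| E` gives `E`. -/
theorem kreinMatrix_trivial (E : S.PrimitiveIdempotent) {E₀ : S.PrimitiveIdempotent}
    (h₀ : E₀.IsTrivial) {H : S.PrimitiveIdempotent} (h : S.kreinMatrix E E₀ H ≠ 0) : H = E := by
  have h1 := S.idempotentCoeff_dualEigenvalue_pow E h₀ H 1
  rw [pow_one, pow_one, idempotentCoeff_apply, ofCoord_dualEigenvalue,
    ← S.idempotentBasis_apply E, map_smul, Module.Basis.repr_self] at h1
  by_contra hne
  rw [Finsupp.smul_apply, Finsupp.single_eq_of_ne hne, smul_zero] at h1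
  exact mul_ne_zero S.card_ne_zero h h1.symm

end

end SymmetricAssociationScheme

/-! ### From a Q-polynomial ordering to the eigenvalue formula. -/

namespace SymmetricAssociationScheme

open Matrix Polynomial

variable {X : Type*} {d : ℕ} (S : SymmetricAssociationScheme X d) [Fintype X] [DecidableEq X]

theorem IsQPolynomialOrdering.idempotentCoeff_eval_of_monic {S : SymmetricAssociationScheme X d}
    {e : Fin (d + 1) ≃ S.PrimitiveIdempotent} (he : S.IsQPolynomialOrdering e)
    (j : Fin (d + 1)) :
    ∃ K : ℝ, K ≠ 0 ∧ ∀ p : ℝ[X], p.Monic → p.natDegree = j →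
      S.idempotentCoeff (e j) (fun i => p.eval (S.dualEigenvalue (e 1) i)) = K := by
  obtain ⟨h₀, hq⟩ := he
  -- The matrix holds q^k_{1i} while the ordering is defined by q^1_{ik}; the two vanish together.
  have hz : ∀ i k, S.kreinMatrix (e 1) (e i) (e k) = 0 ↔ S.krein (e 1) (e i) (e k) = 0 :=
    fun i k => S.krein_eq_zero_rotate _ _ _
  have hB := Matrix.pow_apply_of_tridiagonal (B := S.kreinMatrix (e 1)) e
    (fun i k hik => (hz i k).2 ((hq i k).1 (by
      rw [abs_sub_comm, lt_abs]; left; omega)))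
    (fun i k hik h => (hq i k).2 (by
      rw [abs_sub_comm, ← hik]; simp) ((hz i k).1 h))
  refine ⟨Fintype.card X * (S.kreinMatrix (e 1) ^ (j : ℕ)) (e 0) (e j),
    mul_ne_zero S.card_ne_zero ((hB j j).2 rfl), fun p hp hpj => ?_⟩
  rw [S.idempotentCoeff_eval (e 1) h₀, Finset.sum_range_succ, Finset.sum_eq_zero, zero_add,
    hp.coeff_natDegree, one_mul, hpj]
  intro r hr
  rw [(hB r j).1 (hpj ▸ Finset.mem_range.1 hr), mul_zero, mul_zero]

theorem IsQPolynomialOrdering.dualEigenvalue_injective {S : SymmetricAssociationScheme X d}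
    {e : Fin (d + 1) ≃ S.PrimitiveIdempotent} (he : S.IsQPolynomialOrdering e) :
    Function.Injective (S.dualEigenvalue (e 1)) := by
  by_contra hinj
  let s := Finset.univ.image (S.dualEigenvalue (e 1))
  have hs : s.card < d + 1 := by
    refine lt_of_le_of_ne (Finset.card_image_le.trans (by simp)) fun h => hinj ?_
    rw [← Set.injOn_univ, ← Finset.coe_univ]
    exact Finset.card_image_iff.1 (by simpa [s] using h)
  obtain ⟨K, hK, h⟩ := he.idempotentCoeff_eval_of_monic ⟨s.card, hs⟩
  refine hK ?_
  -- With a repeated dual eigenvalue, this monic polynomial has degree at most d and vanishes at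
  -- every θ*_i, so its coefficient K would be 0.
  rw [← h (∏ t ∈ s, (Polynomial.X - C t)) (monic_prod_X_sub_C _ _)
    (natDegree_finsetProd_X_sub_C_eq_card s _)]
  refine (congrArg _ (funext fun i => ?_)).trans (map_zero (S.idempotentCoeff (e ⟨s.card, hs⟩)))
  rw [eval_prod]
  exact Finset.prod_eq_zero (Finset.mem_image_of_mem _ (Finset.mem_univ i)) (by simp)

theorem IsQPolynomialOrdering.eigenvalue_last {S : SymmetricAssociationScheme X d}
    {e : Fin (d + 1) ≃ S.PrimitiveIdempotent} (he : S.IsQPolynomialOrdering e)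
    (i : Fin (d + 1)) :
    S.eigenvalue i (e (Fin.last d)) =
      (∏ j ∈ Finset.univ.erase 0, (S.dualEigenvalue (e 1) 0 - S.dualEigenvalue (e 1) j)) /
        (∏ j ∈ Finset.univ.erase i, (S.dualEigenvalue (e 1) i - S.dualEigenvalue (e 1) j)) := by
  have hinj := he.dualEigenvalue_injective
  obtain ⟨K, -, h⟩ := he.idempotentCoeff_eval_of_monic (Fin.last d)
  have key : ∀ i, (∏ j ∈ Finset.univ.erase i,
      (S.dualEigenvalue (e 1) i - S.dualEigenvalue (e 1) j)) *
        S.eigenvalue i (e (Fin.last d)) = K := by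
    intro i
    -- This monic polynomial of degree d vanishes at every θ*_k except θ*_i, which isolates one
    -- eigenvalue. The value K does not depend on i, and i = 0, where the eigenvalue is 1,
    -- identifies it.
    rw [← h (∏ j ∈ Finset.univ.erase i, (Polynomial.X - C (S.dualEigenvalue (e 1) j)))
      (monic_prod_X_sub_C _ _) (by
        rw [natDegree_prod_of_monic _ _ fun j _ => monic_X_sub_C _]
        simp [Finset.card_erase_of_mem])]
    rw [idempotentCoeff_eq_sum, Finset.sum_eq_single i]
    · simp [eval_prod]
    · intro k _ hk
      rw [eval_prod, Finset.prod_eq_zero (Finset.mem_erase.2 ⟨hk, Finset.mem_univ k⟩) (by simp),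
        zero_mul]
    · simp
  have h0 := key 0
  rw [eigenvalue_zero, mul_one] at h0
  rw [h0, eq_div_iff, mul_comm, key i]
  exact Finset.prod_ne_zero_iff.2 fun j hj =>
    sub_ne_zero.2 (hinj.ne (Finset.ne_of_mem_erase hj).symm)

/-! ### From the eigenvalue formula to a Q-polynomial ordering. -/

/-- If the eigenvalues for `F` are proportional to the Lagrange weights of the dual eigenvalues of
`E`, then `F` is first reached from the trivial primitive idempotent after `d` entrywise
multiplications by `E`. -/
theorem kreinMatrix_pow_of_eigenvalue {E F E₀ : S.PrimitiveIdempotent} (h₀ : E₀.IsTrivial)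
    (hinj : Function.Injective (S.dualEigenvalue E))
    (hF : ∀ i : Fin (d + 1), S.eigenvalue i F =
      (∏ j ∈ Finset.univ.erase 0, (S.dualEigenvalue E 0 - S.dualEigenvalue E j)) /
        (∏ j ∈ Finset.univ.erase i, (S.dualEigenvalue E i - S.dualEigenvalue E j))) :
    (∀ r < d, (S.kreinMatrix E ^ r) E₀ F = 0) ∧ (S.kreinMatrix E ^ d) E₀ F ≠ 0 := by
  have key : ∀ r ≤ d, (Fintype.card X : ℝ) * (S.kreinMatrix E ^ r) E₀ F =
      (∏ j ∈ Finset.univ.erase 0, (S.dualEigenvalue E 0 - S.dualEigenvalue E j)) *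
        if r = d then 1 else 0 := by
    intro r hr
    -- On d + 1 nodes, summing values against the Lagrange weights extracts the coefficient of X^d,
    -- here 1 or 0 according to whether r = d.
    have h := Lagrange.coeff_eq_sum (s := Finset.univ) hinj.injOn (P := (Polynomial.X : ℝ[X]) ^ r)
      (by rw [degree_X_pow, Finset.card_univ, Fintype.card_fin]
          exact_mod_cast Nat.lt_succ_of_le hr)
    rw [coeff_X_pow, Finset.card_univ, Fintype.card_fin, Nat.add_sub_cancel] at h
    rw [← S.idempotentCoeff_dualEigenvalue_pow E h₀, idempotentCoeff_eq_sum]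
    simp only [eq_comm (a := r)]
    rw [h, Finset.mul_sum]
    refine Finset.sum_congr rfl fun i _ => ?_
    rw [hF i, eval_pow, eval_X, Pi.pow_apply]
    ring
  refine ⟨fun r hr => ?_, fun h => ?_⟩
  · have h := key r hr.le
    rw [if_neg hr.ne, mul_zero] at h
    exact (mul_eq_zero.1 h).resolve_left S.card_ne_zero
  · have h' := key d le_rfl
    rw [h, mul_zero, if_pos rfl, mul_one] at h'
    exact Finset.prod_ne_zero_iff.2 (fun j hj =>
      sub_ne_zero.2 (hinj.ne (Finset.ne_of_mem_erase hj).symm)) h'.symm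

theorem isQPolynomialWithLast_of_kreinMatrix_pow {E F E₀ : S.PrimitiveIdempotent}
    (h₀ : E₀.IsTrivial) (hE : ¬ E.IsTrivial)
    (hmin : ∀ r < d, (S.kreinMatrix E ^ r) E₀ F = 0) (hd : (S.kreinMatrix E ^ d) E₀ F ≠ 0) :
    S.IsQPolynomialWithLast E F := by
  have hB : ∀ G H, 0 ≤ S.kreinMatrix E G H := fun G H => S.krein_nonneg H E G
  obtain ⟨v, hv0, hvd, hv⟩ := Matrix.exists_walk_of_pow_apply_ne_zero hd
  have hwalk : ∀ {i j : ℕ}, i < j → j ≤ d →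
      v i ≠ v j ∧ (i + 1 < j → S.kreinMatrix E (v i) (v j) = 0) := fun hij hj =>
    Matrix.walk_of_minimal_length hB hv (by rwa [hv0, hvd]) hij hj
  have hinj : Function.Injective fun i : Fin (d + 1) => v i := by
    intro i j hij
    by_contra hne
    rcases lt_or_gt_of_ne hne with h | h
    · exact (hwalk h (by omega)).1 hij
    · exact (hwalk h (by omega)).1 hij.symm
  -- For d = 0 the only primitive idempotent is the trivial one. Positivity of d also keeps the
  -- literal 1 in `Fin (d + 1)` from wrapping to 0.
  have hd0 : 0 < d := by
    rw [Nat.pos_iff_ne_zero]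
    rintro rfl
    have : Subsingleton S.PrimitiveIdempotent :=
      Fintype.card_le_one_iff_subsingleton.1 S.card_primitiveIdempotent.le
    exact hE (Subsingleton.elim E₀ E ▸ h₀)
  let e := Equiv.ofBijective _ ((Fintype.bijective_iff_injective_and_card _).2
    ⟨hinj, by rw [S.card_primitiveIdempotent, Fintype.card_fin]⟩)
  have he : ∀ i, e i = v i := fun i => rfl
  have he1 : e 1 = E := by
    have h1 : ((1 : Fin (d + 1)) : ℕ) = 1 := by
      rw [Fin.val_one', Nat.mod_eq_of_lt (by omega)]
    rw [he, h1]
    -- The only edge out of E₀ leads to E, so the path passes through E first.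
    exact S.kreinMatrix_trivial E h₀ (hv0 ▸ hv 0 hd0)
  have hrot : ∀ G H, S.krein E G H = 0 ↔ S.kreinMatrix E G H = 0 :=
    fun G H => (S.krein_eq_zero_rotate H E G).symm
  refine ⟨e, ⟨by rw [he]; exact hv0 ▸ h₀, fun i j => ?_⟩, he1, by rw [he]; exact hvd⟩
  rw [he1]
  -- The path controls entries in the forward direction only; symmetry of q^1_{ij} in i and j
  -- supplies the rest.
  wlog hij : i ≤ j generalizing i j
  · rw [krein_comm, abs_sub_comm]
    exact this j i (le_of_not_ge hij)
  have hij' : (i : ℕ) ≤ j := hij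
  rw [abs_sub_comm, abs_of_nonneg (by omega), ne_eq, hrot]
  refine ⟨fun h => (hwalk (by omega) (by omega)).2 (by omega), fun h => ?_⟩
  have hj : (j : ℕ) = i + 1 := by omega
  rw [he, he, hj]
  exact hv i (by omega)

end SymmetricAssociationScheme

theorem theorem1p1 {X : Type*} [Fintype X] [DecidableEq X] {d : ℕ}
    (S : SymmetricAssociationScheme X d) (E F : S.PrimitiveIdempotent) (hE : ¬ E.IsTrivial) :
    S.IsQPolynomialWithLast E F ↔
      Function.Injective (S.dualEigenvalue E) ∧
      ∀ i : Fin (d + 1), S.eigenvalue i F =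
        (∏ j ∈ Finset.univ.erase 0, (S.dualEigenvalue E 0 - S.dualEigenvalue E j)) /
          (∏ j ∈ Finset.univ.erase i, (S.dualEigenvalue E i - S.dualEigenvalue E j)) := by
  constructor
  · rintro ⟨e, he, rfl, rfl⟩
    exact ⟨he.dualEigenvalue_injective, he.eigenvalue_last⟩
  · rintro ⟨hinj, hF⟩
    obtain ⟨E₀, h₀⟩ := S.exists_isTrivial
    obtain ⟨hmin, hd⟩ := S.kreinMatrix_pow_of_eigenvalue h₀ hinj hF
    exact S.isQPolynomialWithLast_of_kreinMatrix_pow h₀ hE hmin hd
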